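/- Let $(M,J)$ be a complex manifold of dimension $n\ge 0$ with a smooth Hermitian metric $g$ and Hermitian form $\omega=g(J\cdot,\cdot)$. In local holomorphic coordinates $z_1,\dots,z_n$, write $\overline\partial_k=\partial/\partial\overline z_k$, and define the torsion bivector field of $\omega$ by $$\sigma_\omega=\sum_{k=1}^n\Big[g^{-1}d\overline z_k,\ (g^{-1}\otimes g^{-1})\big(\iota_{\overline\partial_k}\, i\partial\omega\big)\Big]^{0,2},$$ where $[\cdot,\cdot]$ is the Schouten bracket and $(\cdot)^{0,2}$ is the projection to $\Lambda^2T^{0,1}$. Let $\nabla^B=\nabla^g-\tfrac12 g^{-1}d^c\omega$ be the Bismut connection, where $\nabla^g$ is the Levi-Civita connection and $d^c=i(\overline\partial-\partial)$, with curvature $R$. Let $\rho_B(V,W)=\tfrac12\sum_{j=1}^{2n} g(R(V,W)Je_j,e_j)$ be the Bismut--Ricci form, where $e_1,\dots,e_{2n}$ is any $g$-orthonormal basis of the tangent space, and let $\rho_B^{2,0}$ be its part of type $(2,0)$. Suppose that $\omega$ is locally conformally Kähler, that is, every point of $M$ has an open neighbourhood $U$ on which $\omega=e^u\omega_0$ for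 a smooth function $u:U\to\mathbb R$ and the Hermitian form $\omega_0$ of a Kähler metric on $U$. Then $\sigma_\omega=0$ in all holomorphic coordinates, and, equivalently, $\rho_B^{2,0}=0$. Here "equivalently" refers to the fact that, for every Hermitian metric, whether or not it is locally conformally Kähler, $\sigma_\omega$ vanishes at a point if and only if $\rho_B^{2,0}$ vanishes at that point. -/

import Mathlib

open scoped ContDiff Manifold TensorProduct

noncomputable section

namespace HermGeom

/-- The model space `ℂⁿ` with its holomorphic coordinates `z₁, …, zₙ`. -/
abbrev Cn (n : ℕ) : Type := EuclideanSpace ℂ (Fin n)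

/-- Labels of the coordinate frame of the complexified tangent bundle:
`inl j` stands for `∂_j = ∂/∂z_j`, and `inr j` stands for `∂̄_j = ∂/∂z̄_j`. -/
abbrev Idx (n : ℕ) : Type := Fin n ⊕ Fin n

/-! ### Tensor calculus in holomorphic coordinates

All tensors below are complex-multilinear extensions of real ones, written in the frame
`∂_1, …, ∂_n, ∂̄_1, …, ∂̄_n` of the complexified tangent bundle of (an open subset of) `ℂⁿ`.
In particular, the members of the frame commute with each other. -/

/-- The constant vector `∂_j = (e_j - i J e_j) / 2` or `∂̄_j = (e_j + i J e_j) / 2` of `ℂ ⊗ T`;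
here `J` is the multiplication by `i` on `ℂⁿ`. -/
def frame {n : ℕ} : Idx n → ℂ ⊗[ℝ] Cn n
  | Sum.inl j => (1 / 2 : ℂ) ⊗ₜ[ℝ] EuclideanSpace.single j 1
      - (Complex.I / 2) ⊗ₜ[ℝ] (Complex.I • EuclideanSpace.single j 1)
  | Sum.inr j => (1 / 2 : ℂ) ⊗ₜ[ℝ] EuclideanSpace.single j 1
      + (Complex.I / 2) ⊗ₜ[ℝ] (Complex.I • EuclideanSpace.single j 1)

/-- The Wirtinger derivatives `∂f/∂z_j` and `∂f/∂z̄_j` of a (real-differentiable) function. -/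
def pd {n : ℕ} (a : Idx n) (f : Cn n → ℂ) (x : Cn n) : ℂ :=
  match a with
  | Sum.inl j => (1 / 2 : ℂ) * (fderiv ℝ f x (EuclideanSpace.single j 1)
      - Complex.I * fderiv ℝ f x (Complex.I • EuclideanSpace.single j 1))
  | Sum.inr j => (1 / 2 : ℂ) * (fderiv ℝ f x (EuclideanSpace.single j 1)
      + Complex.I * fderiv ℝ f x (Complex.I • EuclideanSpace.single j 1))

/-- The eigenvalues of `J` on the frame: `J ∂_j = i ∂_j` and `J ∂̄_j = -i ∂̄_j`. -/
def eigJ {n : ℕ} : Idx n → ℂ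
  | Sum.inl _ => Complex.I
  | Sum.inr _ => -Complex.I

/-- Components of a field of real bilinear forms on `ℂⁿ`, extended complex-bilinearly. -/
def comps {n : ℕ} (b : Cn n → LinearMap.BilinForm ℝ (Cn n)) (x : Cn n) :
    Matrix (Idx n) (Idx n) ℂ :=
  Matrix.of fun a c => LinearMap.BilinForm.baseChange ℂ (b x) (frame a) (frame c)

/-- Components of the exterior derivative of a two-form with components `w`:
`(dw)(∂_a, ∂_b, ∂_c) = ∂_a w_{bc} + ∂_b w_{ca} + ∂_c w_{ab}`. -/
def extD {n : ℕ} (w : Cn n → Matrix (Idx n) (Idx n) ℂ) (x : Cn n) (a b c : Idx n) : ℂ :=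
  pd a (fun y => w y b c) x + pd b (fun y => w y c a) x + pd c (fun y => w y a b) x

/-- The form `∂w`, for a two-form `w` of type `(1,1)`: the part of type `(2,1)` of `dw`. -/
def delD {n : ℕ} (w : Cn n → Matrix (Idx n) (Idx n) ℂ) (x : Cn n) : Idx n → Idx n → Idx n → ℂ
  | Sum.inl i, Sum.inl j, Sum.inr k => extD w x (Sum.inl i) (Sum.inl j) (Sum.inr k)
  | Sum.inl i, Sum.inr j, Sum.inl k => extD w x (Sum.inl i) (Sum.inr j) (Sum.inl k)
  | Sum.inr i, Sum.inl j, Sum.inl k => extD w x (Sum.inr i) (Sum.inl j) (Sum.inl k)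
  | _, _, _ => 0

/-- The form `d^c w = i (∂̄ - ∂) w = - dw(J ·, J ·, J ·)`, for a two-form `w` of type `(1,1)`. -/
def dcD {n : ℕ} (w : Cn n → Matrix (Idx n) (Idx n) ℂ) (x : Cn n) (a b c : Idx n) : ℂ :=
  -(eigJ a * eigJ b * eigJ c * extD w x a b c)

/-- The Schouten bracket `[v, B]` of a complex vector field `v = v^a ∂_a` and a bivector field
`B = (1/2) B^{ab} ∂_a ∧ ∂_b`, that is, the bivector field with
`[v, X ∧ Y] = [v, X] ∧ Y + X ∧ [v, Y]`. -/
def schouten {n : ℕ} (v : Cn n → Idx n → ℂ) (B : Cn n → Matrix (Idx n) (Idx n) ℂ) (x : Cn n) :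
    Matrix (Idx n) (Idx n) ℂ :=
  Matrix.of fun a b => ∑ c, (v x c * pd c (fun y => B y a b) x
    - B x c b * pd c (fun y => v y a) x - B x a c * pd c (fun y => v y b) x)

/-- The vector field `g⁻¹ dz̄_k`, for a metric with components `G`. -/
def sharpDzbar {n : ℕ} (G : Cn n → Matrix (Idx n) (Idx n) ℂ) (k : Fin n) (x : Cn n) : Idx n → ℂ :=
  fun a => (G x)⁻¹ a (Sum.inr k)

/-- The bivector field `(g⁻¹ ⊗ g⁻¹)(ι_{∂̄_k} i ∂w)`, for a metric with components `G` and a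
`(1,1)`-form with components `w`. -/
def torsionContraction {n : ℕ} (G w : Cn n → Matrix (Idx n) (Idx n) ℂ) (k : Fin n) (x : Cn n) :
    Matrix (Idx n) (Idx n) ℂ :=
  Matrix.of fun a b => ∑ c, ∑ d,
    (G x)⁻¹ a c * (G x)⁻¹ b d * (Complex.I * delD w x (Sum.inr k) c d)

/-- Components `σ^{p̄q̄}` (with respect to `∂̄_p ∧ ∂̄_q`, `p < q`) of
`σ = ∑_k [g⁻¹ dz̄_k, (g⁻¹ ⊗ g⁻¹)(ι_{∂̄_k} i ∂w)]^{0,2}`. -/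
def sigmaComps {n : ℕ} (G w : Cn n → Matrix (Idx n) (Idx n) ℂ) (x : Cn n) :
    Matrix (Fin n) (Fin n) ℂ :=
  Matrix.of fun p q =>
    ∑ k, schouten (sharpDzbar G k) (torsionContraction G w k) x (Sum.inr p) (Sum.inr q)

/-- Christoffel symbols `Γ^c_{ab}` of the Levi-Civita connection:
`∇_{∂_a} ∂_b = ∑_c Γ^c_{ab} ∂_c`. -/
def leviCivita {n : ℕ} (G : Cn n → Matrix (Idx n) (Idx n) ℂ) (x : Cn n) (a b c : Idx n) : ℂ :=
  ∑ d, (1 / 2 : ℂ) * (G x)⁻¹ c d *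
    (pd a (fun y => G y b d) x + pd b (fun y => G y a d) x - pd d (fun y => G y a b) x)

/-- Christoffel symbols of the Bismut connection `∇^B = ∇^g - (1/2) g⁻¹ d^c w`, that is,
`g(∇^B_X Y, Z) = g(∇^g_X Y, Z) - (1/2) (d^c w)(X, Y, Z)`. -/
def bismut {n : ℕ} (G w : Cn n → Matrix (Idx n) (Idx n) ℂ) (x : Cn n) (a b c : Idx n) : ℂ :=
  leviCivita G x a b c - (1 / 2 : ℂ) * ∑ d, (G x)⁻¹ c d * dcD w x a b d

/-- Components of the curvature tensor of a connection with Christoffel symbols `Γ`: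
`R(∂_a, ∂_b) ∂_c = ∑_d (curvature Γ x a b c d) ∂_d`. -/
def curvature {n : ℕ} (Γ : Cn n → Idx n → Idx n → Idx n → ℂ) (x : Cn n) (a b c d : Idx n) : ℂ :=
  pd a (fun y => Γ y b c d) x - pd b (fun y => Γ y a c d) x
    + ∑ e, (Γ x a e d * Γ x b c e - Γ x b e d * Γ x a c e)

/-- Components of the Bismut-Ricci form,
`ρ_B(V, W) = (1/2) ∑_j g(R(V, W) J e_j, e_j) = (1/2) tr (R(V, W) ∘ J)`,
where `R` is the curvature of the Bismut connection. -/
def bismutRicciComps {n : ℕ} (G w : Cn n → Matrix (Idx n) (Idx n) ℂ) (x : Cn n) :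
    Matrix (Idx n) (Idx n) ℂ :=
  Matrix.of fun a b => (1 / 2 : ℂ) * ∑ c, eigJ c * curvature (bismut G w) x a b c c

/-! ### Hermitian metrics on complex manifolds -/

section Manifold

variable {n : ℕ} {M : Type*} [TopologicalSpace M] [ChartedSpace (Cn n) M]

/-- A (not necessarily continuous) field of real bilinear forms on the tangent spaces of `M`.
The tangent space of a complex manifold is a complex vector space, and the multiplication by `i`
is the complex structure `J` of `M`. -/
abbrev BilinField (n : ℕ) (M : Type*) [TopologicalSpace M] [ChartedSpace (Cn n) M] :=
  ∀ p : M, LinearMap.BilinForm ℝ (TangentSpace 𝓘(ℂ, Cn n) p)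

/-- The form `ω = g(J ·, ·)`. -/
def hermitianForm (g : BilinField n M) : BilinField n M :=
  fun p => (g p).compLeft
    (LinearMap.restrictScalars ℝ
      (Complex.I • (LinearMap.id :
        TangentSpace 𝓘(ℂ, Cn n) p →ₗ[ℂ] TangentSpace 𝓘(ℂ, Cn n) p)))

/-- The local expression of a field of bilinear forms in a chart `φ`: the pull-back by `φ⁻¹`. -/
def inChart (b : BilinField n M) (φ : OpenPartialHomeomorph M (Cn n)) :
    Cn n → LinearMap.BilinForm ℝ (Cn n) :=
  fun x =>
    let L : TangentSpace 𝓘(ℂ, Cn n) x →ₗ[ℝ] TangentSpace 𝓘(ℂ, Cn n) (φ.symm x) :=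
      LinearMap.restrictScalars ℝ (mfderiv 𝓘(ℂ, Cn n) 𝓘(ℂ, Cn n) φ.symm x).toLinearMap
    (b (φ.symm x)).comp L L

/-- The holomorphic charts of the complex manifold `M`. -/
abbrev holCharts (n : ℕ) (M : Type*) [TopologicalSpace M] [ChartedSpace (Cn n) M] :
    Set (OpenPartialHomeomorph M (Cn n)) :=
  IsManifold.maximalAtlas 𝓘(ℂ, Cn n) ω M

/-- `g` is a (smooth) Hermitian metric on the subset `U` of `M`: a `J`-invariant Riemannian
metric, smooth in holomorphic coordinates. -/
structure IsHermitianMetricOn (g : BilinField n M) (U : Set M) : Prop where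
  symm : ∀ p ∈ U, ∀ v w : TangentSpace 𝓘(ℂ, Cn n) p, g p v w = g p w v
  pos : ∀ p ∈ U, ∀ v : TangentSpace 𝓘(ℂ, Cn n) p, v ≠ 0 → 0 < g p v v
  invariant : ∀ p ∈ U, ∀ v w : TangentSpace 𝓘(ℂ, Cn n) p,
    g p (Complex.I • v) (Complex.I • w) = g p v w
  smooth : ∀ φ ∈ holCharts n M, ∀ v w : Cn n,
    ContDiffOn ℝ ∞ (fun x => inChart g φ x v w) (φ.target ∩ φ.symm ⁻¹' U)

/-- `g` is a Kähler metric on `U`: a Hermitian metric with closed Hermitian form. -/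
structure IsKahlerOn (g : BilinField n M) (U : Set M) : Prop where
  hermitian : IsHermitianMetricOn g U
  closed : ∀ φ ∈ holCharts n M, ∀ x ∈ φ.target ∩ φ.symm ⁻¹' U, ∀ a b c : Idx n,
    extD (comps (inChart (hermitianForm g) φ)) x a b c = 0

/-- The Hermitian form `ω = g(J ·, ·)` is locally conformally Kähler: around every point,
`ω = e^u ω₀` with `u` a smooth real function and `ω₀` the Hermitian form of a Kähler metric. -/
def IsLocallyConformallyKahler (g : BilinField n M) : Prop :=
  ∀ p : M, ∃ U : Set M, IsOpen U ∧ p ∈ U ∧ ∃ (u : M → ℝ) (g₀ : BilinField n M),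
    ContMDiffOn 𝓘(ℝ, Cn n) 𝓘(ℝ, ℝ) ∞ u U ∧ IsKahlerOn g₀ U ∧
      ∀ q ∈ U, hermitianForm g q = Real.exp (u q) • hermitianForm g₀ q

/-- The components, in the holomorphic chart `φ`, of the torsion bivector field `σ_ω` of the
Hermitian form `ω = g(J ·, ·)`. -/
def torsionBivector (g : BilinField n M) (φ : OpenPartialHomeomorph M (Cn n)) (x : Cn n) :
    Matrix (Fin n) (Fin n) ℂ :=
  sigmaComps (comps (inChart g φ)) (comps (inChart (hermitianForm g) φ)) x

/-- The components, in the holomorphic chart `φ`, of the `(2,0)`-part of the Bismut-Ricci form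
of the Hermitian metric `g`. -/
def bismutRicci20 (g : BilinField n M) (φ : OpenPartialHomeomorph M (Cn n)) (x : Cn n) :
    Matrix (Fin n) (Fin n) ℂ :=
  Matrix.of fun j k =>
    bismutRicciComps (comps (inChart g φ)) (comps (inChart (hermitianForm g) φ)) x
      (Sum.inl j) (Sum.inl k)

end Manifold

end HermGeom

end

/-! Write the metric locally as `h = H` with inverse `K`, and let θ be the one-form `bismutTrace`.
Both objects in the theorem are ∂θ in disguise: ρ_B(∂_j, ∂_k) = i(∂_jθ_k − ∂_kθ_j), and σ^{p̄q̄} =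
−∑ K_{pi} K_{qj} (∂_iθ_j − ∂_jθ_i). Hence σ = i·KρKᵀ with `K` invertible, which gives the pointwise
equivalence for every Hermitian metric.

For ρ: the Bismut connection preserves type in (1,0) directions, with trace θ on T^{1,0} and ∂ log
det h − θ on T^{0,1}. The second trace has curl −∂θ because ∂∂ log det h = 0, and the opposite
eigenvalues of `J` make the two contributions add up (`bismutRicciComps_eq`).

For σ: let X_p = ∑ K_{pi} ∂_i be the rows of `K`. The contracted torsion is, up to sign, the bracket
[X_p, X_q] lowered by h, and the Schouten bracket applies ∑ K_{kl} ∂_l to it. Since θ(X_q) = −div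
X_q, the outcome is the Cartan formula for ∂θ(X_p, X_q) (`torsion_eq_curl`, `sigmaComps_eq`).

If h = f h₀ with h₀ Kähler, the Kähler symmetry gives θ = ∂ log f + ∂ log det h₀, which is ∂-closed
(`bismutTrace_closed_of_conformal`), so both tensors vanish.

The identities are proved in a commutative ring with commuting derivations, then applied to
`smoothFun S` with the derivations ∂/∂z_i and evaluated at a point. -/

noncomputable section

namespace HermGeom

/-! ### Identities for an invertible matrix over a ring with commuting derivations -/

section Algebra

variable {R A ι : Type*} [CommRing R] [CommRing A] [Algebra R A] [Fintype ι] [DecidableEq ι]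

/-- The one-form `θ_k = ∑ K_{lm} ∂_m h_{kl}`, the trace of the `(1,0)`-part of the Bismut
connection on `T^{1,0}`. -/
def bismutTrace (D : ι → Derivation R A A) (H K : Matrix ι ι A) (k : ι) : A :=
  ∑ l, ∑ m, K l m * D m (H k l)

/-- The one-form `∂_k log det h = ∑ K_{lm} ∂_k h_{ml}`. -/
def logDetDeriv (D : ι → Derivation R A A) (H K : Matrix ι ι A) (k : ι) : A :=
  ∑ l, ∑ m, K l m * D k (H m l)

/-- The components of the Lie bracket of the vector fields `∑ K_{pi} ∂_i` and `∑ K_{qi} ∂_i`. -/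
def rowBracket (D : ι → Derivation R A A) (K : Matrix ι ι A) (p q j : ι) : A :=
  ∑ i, (K p i * D i (K q j) - K q i * D i (K p j))

omit [Fintype ι] in
theorem derivation_one_apply (d : Derivation R A A) (i j : ι) :
    d ((1 : Matrix ι ι A) i j) = 0 := by
  rw [Matrix.one_apply]; split_ifs <;> simp

theorem sum_mul_derivation_right (d : Derivation R A A) {K H : Matrix ι ι A} (h : K * H = 1)
    (q l : ι) : ∑ j, K q j * d (H j l) = -∑ j, d (K q j) * H j l := by
  have := congrArg d (congrFun (congrFun h q) l)
  rw [Matrix.mul_apply, derivation_one_apply, map_sum] at this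
  simp only [Derivation.leibniz, smul_eq_mul, Finset.sum_add_distrib] at this
  rw [eq_neg_iff_add_eq_zero, ← this]
  simp only [mul_comm]

/-- This is tr(K f H) = tr f. With f_{lj} = ∂_l Y^j it produces the divergence of Y. -/
theorem sum_mul_eq_of_mul_eq_one {H K : Matrix ι ι A} (h : H * K = 1) (f : ι → ι → A) :
    ∑ k, ∑ l, K k l * ∑ j, f l j * H j k = ∑ j, f j j := by
  have h1 : ∀ j l, ∑ k, H j k * K k l = (1 : Matrix ι ι A) j l := fun j l => by
    rw [← h, Matrix.mul_apply]
  calc ∑ k, ∑ l, K k l * ∑ j, f l j * H j k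
      = ∑ k, ∑ l, ∑ j, f l j * (H j k * K k l) := by
        simp only [Finset.mul_sum]
        refine Finset.sum_congr rfl fun k _ => Finset.sum_congr rfl fun l _ =>
          Finset.sum_congr rfl fun j _ => by ring
    _ = ∑ l, ∑ j, f l j * ∑ k, H j k * K k l := by
        simp only [Finset.mul_sum]
        rw [Finset.sum_comm]
        exact Finset.sum_congr rfl fun l _ => Finset.sum_comm
    _ = ∑ j, f j j := by
        simp only [h1, Matrix.one_apply, mul_ite, mul_one, mul_zero, Finset.sum_ite_eq',
          Finset.mem_univ, if_true]

omit [DecidableEq ι] in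
theorem sum_mul_bismutTrace (D : ι → Derivation R A A) (H K : Matrix ι ι A) (f : ι → A) :
    ∑ k, ∑ l, K k l * ∑ j, f j * D l (H j k) = ∑ j, f j * bismutTrace D H K j := by
  simp only [bismutTrace, Finset.mul_sum]
  rw [Finset.sum_comm' (t' := Finset.univ) (s' := fun _ => Finset.univ) (by simp)]
  calc _ = ∑ l, ∑ j, ∑ k, K k l * (f j * D l (H j k)) :=
        Finset.sum_congr rfl fun l _ => Finset.sum_comm
    _ = ∑ j, ∑ l, ∑ k, K k l * (f j * D l (H j k)) := Finset.sum_comm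
    _ = ∑ j, ∑ k, ∑ l, K k l * (f j * D l (H j k)) :=
        Finset.sum_congr rfl fun j _ => Finset.sum_comm
    _ = _ := Finset.sum_congr rfl fun j _ => Finset.sum_congr rfl fun l _ =>
        Finset.sum_congr rfl fun k _ => by ring

/-- θ(X_q) = −div X_q: lowering X_q by h gives the constant row δ_{qk}; apply ∑ K_{kl} ∂_l to it and
use the product rule. -/
theorem row_bismutTrace (D : ι → Derivation R A A) {H K : Matrix ι ι A} (h : H * K = 1)
    (q : ι) : ∑ j, K q j * bismutTrace D H K j = -∑ l, D l (K q l) := by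
  rw [← sum_mul_bismutTrace D H K, ← sum_mul_eq_of_mul_eq_one h (fun l j => D l (K q j)),
    ← Finset.sum_neg_distrib]
  refine Finset.sum_congr rfl fun k _ => ?_
  rw [← Finset.sum_neg_distrib]
  refine Finset.sum_congr rfl fun l _ => ?_
  rw [sum_mul_derivation_right (D l) (mul_eq_one_comm.mp h) q k, mul_neg]

/-- Because `K * H = 1`, a derivative of `H` contracted with a row of `K` can be moved onto that
row, which turns the torsion into the bracket of rows. -/
theorem contraction_eq_rowBracket (D : ι → Derivation R A A) {H K : Matrix ι ι A}
    (h : H * K = 1) (p q k : ι) :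
    ∑ i, ∑ j, K p i * K q j * (D i (H j k) - D j (H i k)) =
      -∑ j, rowBracket D K p q j * H j k := by
  have h' := mul_eq_one_comm.mp h
  have e1 : ∀ p q, ∑ i, ∑ j, K p i * K q j * D i (H j k) =
      -∑ j, (∑ i, K p i * D i (K q j)) * H j k := fun p q => by
    simp only [Finset.sum_mul]
    rw [Finset.sum_comm (γ := ι) (f := fun j i => K p i * D i (K q j) * H j k),
      ← Finset.sum_neg_distrib]
    refine Finset.sum_congr rfl fun i _ => ?_
    simp only [mul_assoc]
    rw [← Finset.mul_sum, ← Finset.mul_sum, sum_mul_derivation_right (D i) h' q k, mul_neg]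
  have e2 : ∑ i, ∑ j, K p i * K q j * D j (H i k) = ∑ i, ∑ j, K q i * K p j * D i (H j k) := by
    rw [Finset.sum_comm]
    refine Finset.sum_congr rfl fun i _ => Finset.sum_congr rfl fun j _ => by ring
  simp only [mul_sub, Finset.sum_sub_distrib, e2, e1, rowBracket, sub_mul]
  ring

omit [DecidableEq ι] in
/-- `div [X, Y] = X (div Y) - Y (div X)` for the rows `X = ∑ K_{pi} ∂_i` and
`Y = ∑ K_{qi} ∂_i`. -/
theorem sum_derivation_rowBracket (D : ι → Derivation R A A)
    (hD : ∀ i j f, D i (D j f) = D j (D i f)) (K : Matrix ι ι A) (p q : ι) :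
    ∑ j, D j (rowBracket D K p q j) =
      ∑ i, (K p i * D i (∑ l, D l (K q l)) - K q i * D i (∑ l, D l (K p l))) := by
  -- The last sum, quadratic in first derivatives, is symmetric in p and q, so it cancels in the
  -- bracket.
  have key : ∀ p q, ∑ j, ∑ i, D j (K p i * D i (K q j)) =
      ∑ i, K p i * D i (∑ l, D l (K q l)) + ∑ j, ∑ i, D i (K q j) * D j (K p i) := by
    intro p q
    simp only [Derivation.leibniz, smul_eq_mul, Finset.sum_add_distrib, map_sum, Finset.mul_sum]
    congr 1
    rw [Finset.sum_comm]
    refine Finset.sum_congr rfl fun i _ => Finset.sum_congr rfl fun j _ => by rw [hD]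
  simp only [rowBracket, map_sum, map_sub, Finset.sum_sub_distrib] at key ⊢
  rw [key p q, key q p]
  have : ∑ j, ∑ i, D i (K q j) * D j (K p i) = ∑ j, ∑ i, D i (K p j) * D j (K q i) := by
    rw [Finset.sum_comm]
    refine Finset.sum_congr rfl fun i _ => Finset.sum_congr rfl fun j _ => by ring
  rw [this]
  ring

/-- Put Y = [X_p, X_q]. The left side is −θ(Y) − div Y by the product rule. The right side is X_p
θ(X_q) − X_q θ(X_p) − θ(Y), which agrees because θ(X) = −div X on rows and div Y = X_p div X_q − X_q
div X_p. -/
theorem torsion_eq_curl (D : ι → Derivation R A A)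
    (hD : ∀ i j f, D i (D j f) = D j (D i f)) {H K : Matrix ι ι A} (h : H * K = 1) (p q : ι) :
    ∑ k, ∑ l, K k l * D l (∑ i, ∑ j, K p i * K q j * (D i (H j k) - D j (H i k))) =
      ∑ i, ∑ j, K p i * K q j *
        (D i (bismutTrace D H K j) - D j (bismutTrace D H K i)) := by
  have e1 : ∀ k l, D l (∑ i, ∑ j, K p i * K q j * (D i (H j k) - D j (H i k))) =
      -(∑ j, rowBracket D K p q j * D l (H j k)) -
        ∑ j, D l (rowBracket D K p q j) * H j k := fun k l => by
    rw [contraction_eq_rowBracket D h, map_neg, map_sum]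
    simp only [Derivation.leibniz, smul_eq_mul, Finset.sum_add_distrib, mul_comm]
    ring
  simp only [e1]
  simp only [mul_sub, mul_neg, Finset.sum_sub_distrib, Finset.sum_neg_distrib]
  rw [sum_mul_bismutTrace D H K, sum_mul_eq_of_mul_eq_one h
    (fun l j => D l (rowBracket D K p q j)), sum_derivation_rowBracket D hD]
  have e2 : ∀ p q, ∑ i, ∑ j, K p i * K q j * D i (bismutTrace D H K j) =
      -∑ i, K p i * D i (∑ l, D l (K q l)) -
        ∑ j, (∑ i, K p i * D i (K q j)) * bismutTrace D H K j := fun p q => by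
    have : ∀ i, ∑ j, K q j * D i (bismutTrace D H K j) = -D i (∑ l, D l (K q l)) -
        ∑ j, D i (K q j) * bismutTrace D H K j := fun i => by
      rw [← map_neg, ← row_bismutTrace D h, map_sum]
      simp only [Derivation.leibniz, smul_eq_mul, Finset.sum_add_distrib, mul_comm]
      ring
    simp only [mul_assoc, ← Finset.mul_sum, this, mul_sub, Finset.sum_sub_distrib, mul_neg,
      Finset.sum_neg_distrib, Finset.sum_mul]
    congr 1
    simp only [Finset.mul_sum]
    rw [Finset.sum_comm]
  have e3 : ∑ i, ∑ j, K p i * K q j * D j (bismutTrace D H K i) =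
      ∑ i, ∑ j, K q i * K p j * D i (bismutTrace D H K j) := by
    rw [Finset.sum_comm]
    refine Finset.sum_congr rfl fun i _ => Finset.sum_congr rfl fun j _ => by ring
  rw [e3, e2, e2]
  simp only [rowBracket, Finset.sum_sub_distrib, sub_mul]
  ring

/-- ∂∂ log det h = 0 without a logarithm: since dK = −K dH K, the derivative is −tr(K ∂_jH K ∂_kH) +
tr(K ∂_j∂_kH), symmetric in j and k by cyclicity of the trace. -/
theorem logDetDeriv_closed (D : ι → Derivation R A A)
    (hD : ∀ i j f, D i (D j f) = D j (D i f)) {H K : Matrix ι ι A} (h : H * K = 1) (j k : ι) :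
    D j (logDetDeriv D H K k) = D k (logDetDeriv D H K j) := by
  have h' := mul_eq_one_comm.mp h
  have dK : ∀ i, K.map (D i) = -(K * H.map (D i) * K) := fun i => by
    have : K.map (D i) * H = -(K * H.map (D i)) := by
      ext q l
      have := sum_mul_derivation_right (D i) h' q l
      simp [Matrix.mul_apply, this]
    calc K.map (D i) = K.map (D i) * (H * K) := by rw [h, mul_one]
      _ = _ := by rw [← mul_assoc, this, neg_mul]
  have e : ∀ j k, D j (logDetDeriv D H K k) =
      Matrix.trace (K.map (D j) * H.map (D k)) + ∑ l, ∑ m, K l m * D j (D k (H m l)) := by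
    intro j k
    simp only [logDetDeriv, map_sum, Derivation.leibniz, smul_eq_mul, Finset.sum_add_distrib,
      Matrix.trace, Matrix.diag, Matrix.mul_apply, Matrix.map_apply]
    rw [add_comm]
    congr 1
    exact Finset.sum_congr rfl fun _ _ => Finset.sum_congr rfl fun _ _ => mul_comm _ _
  rw [e, e, dK, dK]
  simp only [hD j k, neg_mul, Matrix.trace_neg]
  rw [mul_assoc, Matrix.trace_mul_comm, mul_assoc (K * _) K]

/-- The form `θ` of a metric conformal to a Kähler metric is closed. -/
theorem bismutTrace_closed_of_conformal (D : ι → Derivation R A A)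
    (hD : ∀ i j f, D i (D j f) = D j (D i f)) {H K H₀ : Matrix ι ι A} (h : H * K = 1)
    {f f' : A} (hf : f * f' = 1) (hH : H = f • H₀)
    (hK : ∀ m k l, D m (H₀ k l) = D k (H₀ m l)) (j k : ι) :
    D j (bismutTrace D H K k) = D k (bismutTrace D H K j) := by
  have h0 : H₀ * (f • K) = 1 := by rw [Matrix.mul_smul, ← Matrix.smul_mul, ← hH, h]
  have h1 : ∀ k m, ∑ l, H k l * K l m = (1 : Matrix ι ι A) k m := fun k m => by
    rw [← h, Matrix.mul_apply]
  have hH0 : H₀ = f' • H := by rw [hH, smul_smul, mul_comm, hf, one_smul]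
  -- Here `f' * D k f` plays the role of ∂_k log f, and `f • K` is the inverse of `H₀`. The Kähler
  -- symmetry exchanges m and k in the derivative of `H₀`.
  have e : ∀ k, bismutTrace D H K k = f' * D k f + logDetDeriv D H₀ (f • K) k := by
    intro k
    have : ∀ l m, K l m * D m (H k l) =
        f' * (H k l * K l m * D m f) + (f • K) l m * D k (H₀ m l) := by
      intro l m
      conv_lhs => rw [hH]
      rw [← hK m k l, hH0]
      simp only [Matrix.smul_apply, smul_eq_mul, Derivation.leibniz]
      have hd : f * D m f' = - (f' * D m f) := by
        have := congrArg (D m) hf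
        simp only [Derivation.leibniz, smul_eq_mul, Derivation.map_one_eq_zero] at this
        exact eq_neg_of_add_eq_zero_left this
      linear_combination (K l m * H k l * D m f - K l m * H k l * D m f) * hf
    simp only [bismutTrace, this, Finset.sum_add_distrib, logDetDeriv]
    congr 1
    simp only [← Finset.mul_sum]
    rw [Finset.sum_comm]
    simp only [← Finset.sum_mul, h1, Matrix.one_apply, ite_mul, one_mul, zero_mul,
      Finset.sum_ite_eq, Finset.mem_univ, if_true]
  have hd : ∀ m, D m f' = - (f' * f' * D m f) := fun m => by
    have := congrArg (D m) hf
    simp only [Derivation.leibniz, smul_eq_mul, Derivation.map_one_eq_zero] at this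
    linear_combination f' * this - D m f' * hf
  rw [e, e, map_add, map_add, logDetDeriv_closed D hD h0 j k]
  simp only [Derivation.leibniz, smul_eq_mul, hd, hD j k f]
  ring

end Algebra

/-! ### Wirtinger derivatives as derivations of a ring of smooth functions -/

section Smooth

variable {n : ℕ}

theorem pd_eq (a : Idx n) (f : Cn n → ℂ) (x : Cn n) :
    pd a f x = (1 / 2 : ℂ) * (fderiv ℝ f x (EuclideanSpace.single (Sum.elim id id a) 1)
      - eigJ a * fderiv ℝ f x (Complex.I • EuclideanSpace.single (Sum.elim id id a) 1)) := by
  cases a <;> simp [pd, eigJ]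

theorem pd_congr {f g : Cn n → ℂ} {S : Set (Cn n)} (hS : IsOpen S) (h : ∀ y ∈ S, f y = g y)
    {x : Cn n} (hx : x ∈ S) (a : Idx n) : pd a f x = pd a g x := by
  have : f =ᶠ[nhds x] g := Filter.eventuallyEq_of_mem (hS.mem_nhds hx) h
  rw [pd_eq, pd_eq, this.fderiv_eq]

theorem pd_add (a : Idx n) {f g : Cn n → ℂ} {x : Cn n} (hf : DifferentiableAt ℝ f x)
    (hg : DifferentiableAt ℝ g x) : pd a (f + g) x = pd a f x + pd a g x := by
  simp only [pd_eq, fderiv_add hf hg, add_apply]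
  ring

theorem pd_mul (a : Idx n) {f g : Cn n → ℂ} {x : Cn n} (hf : DifferentiableAt ℝ f x)
    (hg : DifferentiableAt ℝ g x) : pd a (f * g) x = f x * pd a g x + g x * pd a f x := by
  simp only [pd_eq, fderiv_mul hf hg, add_apply,
    smul_apply, smul_eq_mul]
  ring

theorem pd_const_smul (a : Idx n) (c : ℂ) {f : Cn n → ℂ} {x : Cn n}
    (hf : DifferentiableAt ℝ f x) : pd a (c • f) x = c * pd a f x := by
  simp only [pd_eq, fderiv_const_smul hf, smul_apply, smul_eq_mul]
  ring

theorem pd_comm (a b : Idx n) {f : Cn n → ℂ} {x : Cn n} (hf : ContDiffAt ℝ ∞ f x) :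
    pd a (pd b f) x = pd b (pd a f) x := by
  have h2f : (2 : WithTop ℕ∞) ≤ ∞ := ENat.LEInfty.out
  have hd : DifferentiableAt ℝ (fderiv ℝ f) x :=
    ((hf.of_le h2f).fderiv_right (m := 1) le_rfl).differentiableAt one_ne_zero
  have hv : ∀ v, DifferentiableAt ℝ (fun y => fderiv ℝ f y v) x := fun v =>
    hd.clm_apply (differentiableAt_const v)
  have h2 : ∀ v w, fderiv ℝ (fun y => fderiv ℝ f y v) x w = fderiv ℝ (fderiv ℝ f) x w v := by
    intro v w
    rw [fderiv_clm_apply hd (differentiableAt_const v)]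
    simp
  have hs := hf.isSymmSndFDerivAt (by simpa using h2f)
  have key : ∀ a b : Idx n, pd a (pd b f) x = (1 / 2 : ℂ) * (1 / 2 : ℂ) *
      (fderiv ℝ (fderiv ℝ f) x (EuclideanSpace.single (Sum.elim id id a) 1)
          (EuclideanSpace.single (Sum.elim id id b) 1)
        - eigJ b * fderiv ℝ (fderiv ℝ f) x (EuclideanSpace.single (Sum.elim id id a) 1)
          (Complex.I • EuclideanSpace.single (Sum.elim id id b) 1)
        - eigJ a * (fderiv ℝ (fderiv ℝ f) x
            (Complex.I • EuclideanSpace.single (Sum.elim id id a) 1)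
            (EuclideanSpace.single (Sum.elim id id b) 1)
          - eigJ b * fderiv ℝ (fderiv ℝ f) x
            (Complex.I • EuclideanSpace.single (Sum.elim id id a) 1)
            (Complex.I • EuclideanSpace.single (Sum.elim id id b) 1))) := by
    intro a b
    have e : pd b f = fun y =>
        (1 / 2 : ℂ) * (fderiv ℝ f y (EuclideanSpace.single (Sum.elim id id b) 1)
          - eigJ b * fderiv ℝ f y (Complex.I • EuclideanSpace.single (Sum.elim id id b) 1)) :=
      funext fun y => pd_eq b f y
    rw [pd_eq, e, fderiv_const_mul ((hv _).fun_sub ((hv _).const_mul _)),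
      fderiv_fun_sub (hv _) ((hv _).const_mul _), fderiv_const_mul (hv _)]
    simp only [smul_apply, sub_apply, h2, smul_eq_mul]
    ring
  rw [key, key, hs.eq (EuclideanSpace.single (Sum.elim id id a) 1),
    hs.eq (EuclideanSpace.single (Sum.elim id id a) 1),
    hs.eq (Complex.I • EuclideanSpace.single (Sum.elim id id a) 1),
    hs.eq (Complex.I • EuclideanSpace.single (Sum.elim id id a) 1)]
  ring

theorem contDiffOn_pd {S : Set (Cn n)} (hS : IsOpen S) {f : Cn n → ℂ}
    (hf : ContDiffOn ℝ ∞ f S) (a : Idx n) : ContDiffOn ℝ ∞ (pd a f) S := by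
  have h := hf.fderiv_of_isOpen (m := ∞) hS (by simp)
  have hv : ∀ v, ContDiffOn ℝ ∞ (fun y => fderiv ℝ f y v) S := fun v =>
    h.clm_apply contDiffOn_const
  have e : pd a f = fun y =>
      (1 / 2 : ℂ) * (fderiv ℝ f y (EuclideanSpace.single (Sum.elim id id a) 1)
        - eigJ a * fderiv ℝ f y (Complex.I • EuclideanSpace.single (Sum.elim id id a) 1)) :=
    funext fun y => pd_eq a f y
  rw [e]
  exact contDiffOn_const.mul ((hv _).sub (contDiffOn_const.mul (hv _)))

/-- The algebra of complex functions that are smooth on `S`. -/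
def smoothFun (S : Set (Cn n)) : Subalgebra ℂ (Cn n → ℂ) where
  carrier := {f | ContDiffOn ℝ ∞ f S}
  mul_mem' hf hg := ContDiffOn.mul hf hg
  add_mem' hf hg := ContDiffOn.add hf hg
  algebraMap_mem' _ := contDiffOn_const

theorem smoothFun.differentiableAt {S : Set (Cn n)} (hS : IsOpen S) (f : smoothFun S)
    {x : Cn n} (hx : x ∈ S) : DifferentiableAt ℝ (f : Cn n → ℂ) x :=
  ((f.2 : ContDiffOn ℝ ∞ f.1 S).contDiffAt (hS.mem_nhds hx)).differentiableAt (by simp)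

/-- The Wirtinger derivative as a derivation of the algebra of functions smooth on an open set;
outside of that set, its values are set to zero. -/
def pdOn {S : Set (Cn n)} (hS : IsOpen S) (a : Idx n) :
    Derivation ℂ (smoothFun S) (smoothFun S) :=
  Derivation.mk'
    { toFun := fun f => ⟨S.indicator (pd a f.1),
        (contDiffOn_pd hS f.2 a).congr fun _ hy => Set.indicator_of_mem hy _⟩
      map_add' := fun f g => Subtype.ext <| funext fun x => by
        by_cases hx : x ∈ S
        · simpa [hx] using pd_add a (smoothFun.differentiableAt hS f hx) (smoothFun.differentiableAt hS g hx)
        · simp [hx]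
      map_smul' := fun c f => Subtype.ext <| funext fun x => by
        by_cases hx : x ∈ S
        · simpa [hx] using pd_const_smul a c (smoothFun.differentiableAt hS f hx)
        · simp [hx] }
    fun f g => Subtype.ext <| funext fun x => by
      by_cases hx : x ∈ S
      · simpa [hx] using pd_mul a (smoothFun.differentiableAt hS f hx) (smoothFun.differentiableAt hS g hx)
      · simp [hx]

theorem pdOn_apply {S : Set (Cn n)} (hS : IsOpen S) (a : Idx n) (f : smoothFun S) {x : Cn n}
    (hx : x ∈ S) : (pdOn hS a f).1 x = pd a f.1 x :=
  Set.indicator_of_mem hx _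

theorem pd_eq_pdOn {S : Set (Cn n)} (hS : IsOpen S) (a : Idx n) {f : Cn n → ℂ}
    (F : smoothFun S) (h : ∀ y ∈ S, f y = F.1 y) {x : Cn n} (hx : x ∈ S) :
    pd a f x = (pdOn hS a F).1 x := by
  rw [pdOn_apply hS a F hx, pd_congr hS h hx]

theorem pdOn_comm {S : Set (Cn n)} (hS : IsOpen S) (a b : Idx n) (f : smoothFun S) :
    pdOn hS a (pdOn hS b f) = pdOn hS b (pdOn hS a f) := by
  refine Subtype.ext <| funext fun x => ?_
  by_cases hx : x ∈ S
  · rw [pdOn_apply hS _ _ hx, pdOn_apply hS _ _ hx,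
      pd_congr hS (fun y hy => pdOn_apply hS b f hy) hx,
      pd_congr hS (fun y hy => pdOn_apply hS a f hy) hx]
    exact pd_comm a b ((f.2 : ContDiffOn ℝ ∞ f.1 S).contDiffAt (hS.mem_nhds hx))
  · exact (Set.indicator_of_notMem hx _).trans (Set.indicator_of_notMem hx _).symm

/-- Evaluation of functions at a point. -/
def evalAt (S : Set (Cn n)) (x : Cn n) : smoothFun S →+* ℂ :=
  (Pi.evalRingHom (fun _ => ℂ) x).comp (smoothFun S).val.toRingHom

theorem evalAt_apply {S : Set (Cn n)} (x : Cn n) (f : smoothFun S) : evalAt S x f = f.1 x := rfl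

/-- Elements of `smoothFun S` are functions on all of ℂⁿ, so a unit must be nonzero off `S` as well.
-/
theorem isUnit_smoothFun {S : Set (Cn n)} (f : smoothFun S) (h : ∀ x, f.1 x ≠ 0) :
    IsUnit f := by
  refine IsUnit.of_mul_eq_one ⟨fun x => (f.1 x)⁻¹, ContDiffOn.inv f.2 fun x _ => h x⟩
    (Subtype.ext <| funext fun x => ?_)
  exact mul_inv_cancel₀ (h x)

/-- A matrix of smooth functions that is pointwise invertible on `S` has a smooth inverse, after
a modification outside of `S`. -/
theorem exists_smooth_inverse {ι : Type*} [Fintype ι] [DecidableEq ι] {S : Set (Cn n)}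
    (h : Cn n → Matrix ι ι ℂ) (hs : ∀ i j, ContDiffOn ℝ ∞ (fun y => h y i j) S)
    (hu : ∀ y ∈ S, IsUnit (h y)) :
    ∃ H K : Matrix ι ι (smoothFun S), H * K = 1 ∧ ∀ y ∈ S, ∀ i j, (H i j).1 y = h y i j := by
  classical
  -- The value 1 off `S` makes the determinant nonzero everywhere, hence a unit of the ring.
  let h' : Cn n → Matrix ι ι ℂ := fun y => if y ∈ S then h y else 1
  have hS' : ∀ y ∈ S, h' y = h y := fun y hy => if_pos hy
  let H : Matrix ι ι (smoothFun S) := Matrix.of fun i j => ⟨fun y => h' y i j,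
    (hs i j).congr fun y hy => by simp [hS' y hy]⟩
  have hmap : ∀ y, (evalAt S y).mapMatrix H = h' y := fun y => by ext i j; rfl
  have hdet : IsUnit H.det := by
    refine isUnit_smoothFun _ fun y => ?_
    rw [← evalAt_apply, RingHom.map_det, hmap, ← isUnit_iff_ne_zero,
      ← Matrix.isUnit_iff_isUnit_det]
    by_cases hy : y ∈ S
    · rw [hS' y hy]; exact hu y hy
    · simp [h', hy]
  exact ⟨H, H⁻¹, Matrix.mul_nonsing_inv _ hdet,
    fun y hy i j => congrFun (congrFun (hS' y hy) i) j⟩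

end Smooth

/-! ### Torsion bivector and Bismut-Ricci form in terms of θ -/

section LocalFormulas

variable {n : ℕ} {S : Set (Cn n)}

/-- `G` and `w` are the components on `S` of a Hermitian metric `∑ H_{jk} dz_j dz̄_k` and of its
Hermitian form, and `K` is the inverse of `H`. -/
structure IsHermitianFrame (S : Set (Cn n)) (G w : Cn n → Matrix (Idx n) (Idx n) ℂ)
    (H K : Matrix (Fin n) (Fin n) (smoothFun S)) : Prop where
  mul_eq_one : H * K = 1
  metric : ∀ y ∈ S, G y =
    Matrix.fromBlocks 0 ((evalAt S y).mapMatrix H) ((evalAt S y).mapMatrix H).transpose 0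
  form : ∀ y ∈ S, ∀ a c, w y a c = eigJ a * G y a c

namespace IsHermitianFrame

variable {G w : Cn n → Matrix (Idx n) (Idx n) ℂ} {H K : Matrix (Fin n) (Fin n) (smoothFun S)}

theorem inv_eq (h : IsHermitianFrame S G w H K) {y : Cn n} (hy : y ∈ S) : (G y)⁻¹ =
    Matrix.fromBlocks 0 ((evalAt S y).mapMatrix K).transpose ((evalAt S y).mapMatrix K) 0 := by
  refine Matrix.inv_eq_right_inv ?_
  have h1 := congrArg (evalAt S y).mapMatrix h.mul_eq_one
  rw [map_mul, map_one] at h1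
  have h2 := mul_eq_one_comm.mp h1
  rw [h.metric y hy, Matrix.fromBlocks_multiply]
  simp only [zero_mul, mul_zero, zero_add, add_zero]
  rw [h1, ← Matrix.transpose_mul, h2, Matrix.transpose_one, Matrix.fromBlocks_one]

theorem inv_ll (h : IsHermitianFrame S G w H K) {y : Cn n} (hy : y ∈ S) (j k : Fin n) :
    (G y)⁻¹ (Sum.inl j) (Sum.inl k) = 0 := by rw [h.inv_eq hy]; rfl

theorem inv_rr (h : IsHermitianFrame S G w H K) {y : Cn n} (hy : y ∈ S) (j k : Fin n) :
    (G y)⁻¹ (Sum.inr j) (Sum.inr k) = 0 := by rw [h.inv_eq hy]; rfl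

theorem inv_lr (h : IsHermitianFrame S G w H K) {y : Cn n} (hy : y ∈ S) (j k : Fin n) :
    (G y)⁻¹ (Sum.inl j) (Sum.inr k) = evalAt S y (K k j) := by rw [h.inv_eq hy]; rfl

theorem inv_rl (h : IsHermitianFrame S G w H K) {y : Cn n} (hy : y ∈ S) (j k : Fin n) :
    (G y)⁻¹ (Sum.inr j) (Sum.inl k) = evalAt S y (K j k) := by rw [h.inv_eq hy]; rfl

theorem pd_ll (h : IsHermitianFrame S G w H K) (hS : IsOpen S) {x : Cn n} (hx : x ∈ S)
    (a : Idx n) (j k : Fin n) : pd a (fun y => G y (Sum.inl j) (Sum.inl k)) x = 0 := by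
  rw [pd_eq_pdOn hS a 0 (fun y hy => by rw [h.metric y hy]; rfl) hx, map_zero]; rfl

theorem pd_rr (h : IsHermitianFrame S G w H K) (hS : IsOpen S) {x : Cn n} (hx : x ∈ S)
    (a : Idx n) (j k : Fin n) : pd a (fun y => G y (Sum.inr j) (Sum.inr k)) x = 0 := by
  rw [pd_eq_pdOn hS a 0 (fun y hy => by rw [h.metric y hy]; rfl) hx, map_zero]; rfl

theorem pd_lr (h : IsHermitianFrame S G w H K) (hS : IsOpen S) {x : Cn n} (hx : x ∈ S)
    (a : Idx n) (j k : Fin n) : pd a (fun y => G y (Sum.inl j) (Sum.inr k)) x =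
      evalAt S x (pdOn hS a (H j k)) :=
  pd_eq_pdOn hS a (H j k) (fun y hy => by rw [h.metric y hy]; rfl) hx

theorem pd_rl (h : IsHermitianFrame S G w H K) (hS : IsOpen S) {x : Cn n} (hx : x ∈ S)
    (a : Idx n) (j k : Fin n) : pd a (fun y => G y (Sum.inr j) (Sum.inl k)) x =
      evalAt S x (pdOn hS a (H k j)) :=
  pd_eq_pdOn hS a (H k j) (fun y hy => by rw [h.metric y hy]; rfl) hx

theorem pd_form_ll (h : IsHermitianFrame S G w H K) (hS : IsOpen S) {x : Cn n} (hx : x ∈ S)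
    (a : Idx n) (j k : Fin n) : pd a (fun y => w y (Sum.inl j) (Sum.inl k)) x = 0 := by
  rw [pd_eq_pdOn hS a 0 (fun y hy => by
    rw [h.form y hy, h.metric y hy]; exact mul_zero _) hx, map_zero]; rfl

theorem pd_form_rr (h : IsHermitianFrame S G w H K) (hS : IsOpen S) {x : Cn n} (hx : x ∈ S)
    (a : Idx n) (j k : Fin n) : pd a (fun y => w y (Sum.inr j) (Sum.inr k)) x = 0 := by
  rw [pd_eq_pdOn hS a 0 (fun y hy => by
    rw [h.form y hy, h.metric y hy]; exact mul_zero _) hx, map_zero]; rfl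

theorem pd_form_lr (h : IsHermitianFrame S G w H K) (hS : IsOpen S) {x : Cn n} (hx : x ∈ S)
    (a : Idx n) (j k : Fin n) : pd a (fun y => w y (Sum.inl j) (Sum.inr k)) x =
      Complex.I * evalAt S x (pdOn hS a (H j k)) := by
  rw [pd_eq_pdOn hS a (Complex.I • H j k) (fun y hy => by
    rw [h.form y hy, h.metric y hy]; rfl) hx, Derivation.map_smul]; rfl

theorem pd_form_rl (h : IsHermitianFrame S G w H K) (hS : IsOpen S) {x : Cn n} (hx : x ∈ S)
    (a : Idx n) (j k : Fin n) : pd a (fun y => w y (Sum.inr j) (Sum.inl k)) x =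
      -Complex.I * evalAt S x (pdOn hS a (H k j)) := by
  rw [pd_eq_pdOn hS a (-Complex.I • H k j) (fun y hy => by
    rw [h.form y hy, h.metric y hy]; rfl) hx, Derivation.map_smul]; rfl

theorem extD_llr (h : IsHermitianFrame S G w H K) (hS : IsOpen S) {x : Cn n} (hx : x ∈ S)
    (i j k : Fin n) : extD w x (Sum.inl i) (Sum.inl j) (Sum.inr k) =
      Complex.I * evalAt S x (pdOn hS (Sum.inl i) (H j k) - pdOn hS (Sum.inl j) (H i k)) := by
  rw [extD, h.pd_form_lr hS hx, h.pd_form_rl hS hx, h.pd_form_ll hS hx, map_sub]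
  ring

theorem extD_lrl (h : IsHermitianFrame S G w H K) (hS : IsOpen S) {x : Cn n} (hx : x ∈ S)
    (i j k : Fin n) : extD w x (Sum.inl i) (Sum.inr k) (Sum.inl j) =
      -Complex.I * evalAt S x (pdOn hS (Sum.inl i) (H j k) - pdOn hS (Sum.inl j) (H i k)) := by
  rw [extD, h.pd_form_lr hS hx, h.pd_form_rl hS hx, h.pd_form_ll hS hx, map_sub]
  ring

theorem extD_rll (h : IsHermitianFrame S G w H K) (hS : IsOpen S) {x : Cn n} (hx : x ∈ S)
    (i j k : Fin n) : extD w x (Sum.inr k) (Sum.inl i) (Sum.inl j) =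
      Complex.I * evalAt S x (pdOn hS (Sum.inl i) (H j k) - pdOn hS (Sum.inl j) (H i k)) := by
  rw [extD, h.pd_form_lr hS hx, h.pd_form_rl hS hx, h.pd_form_ll hS hx, map_sub]
  ring

theorem extD_lll (h : IsHermitianFrame S G w H K) (hS : IsOpen S) {x : Cn n} (hx : x ∈ S)
    (i j k : Fin n) : extD w x (Sum.inl i) (Sum.inl j) (Sum.inl k) = 0 := by
  simp only [extD, h.pd_form_ll hS hx, add_zero]

theorem extD_lrr (h : IsHermitianFrame S G w H K) (hS : IsOpen S) {x : Cn n} (hx : x ∈ S)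
    (i j k : Fin n) : extD w x (Sum.inl i) (Sum.inr j) (Sum.inr k) =
      Complex.I * evalAt S x (pdOn hS (Sum.inr k) (H i j) - pdOn hS (Sum.inr j) (H i k)) := by
  rw [extD, h.pd_form_lr hS hx, h.pd_form_rl hS hx, h.pd_form_rr hS hx, map_sub]
  ring

theorem torsionContraction_rr (h : IsHermitianFrame S G w H K) (hS : IsOpen S) {x : Cn n}
    (hx : x ∈ S) (k p q : Fin n) :
    torsionContraction G w k x (Sum.inr p) (Sum.inr q) =
      evalAt S x (-∑ i, ∑ j, K p i * K q j *
        (pdOn hS (Sum.inl i) (H j k) - pdOn hS (Sum.inl j) (H i k))) := by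
  simp only [torsionContraction, Matrix.of_apply, Fintype.sum_sum_type, h.inv_rl hx,
    mul_zero, Finset.sum_const_zero, add_zero, delD, h.extD_rll hS hx, map_neg, map_sum,
    map_mul, ← Finset.sum_neg_distrib]
  refine Finset.sum_congr rfl fun i _ => Finset.sum_congr rfl fun j _ => ?_
  linear_combination (evalAt S x (K p i) * evalAt S x (K q j) *
    evalAt S x (pdOn hS (Sum.inl i) (H j k) - pdOn hS (Sum.inl j) (H i k))) * Complex.I_mul_I

/-- The field g⁻¹dz̄_k is the row X_k, of type (1,0). Its (0,1)-components vanish identically, so in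
the (0,2)-part of the Schouten bracket only the derivative of the bivector along X_k survives. -/
theorem sigmaComps_eq (h : IsHermitianFrame S G w H K) (hS : IsOpen S) {x : Cn n}
    (hx : x ∈ S) (p q : Fin n) : sigmaComps G w x p q =
      -evalAt S x (∑ i, ∑ j, K p i * K q j *
        (pdOn hS (Sum.inl i) (bismutTrace (fun i => pdOn hS (Sum.inl i)) H K j) -
          pdOn hS (Sum.inl j) (bismutTrace (fun i => pdOn hS (Sum.inl i)) H K i))) := by
  rw [← torsion_eq_curl (fun i => pdOn hS (Sum.inl i)) (fun i j f => pdOn_comm hS _ _ f)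
    h.mul_eq_one p q]
  have hv : ∀ (k p : Fin n) (c : Idx n),
      pd c (fun y => sharpDzbar G k y (Sum.inr p)) x = 0 := fun k p c => by
    rw [pd_eq_pdOn hS c (f := fun y => sharpDzbar G k y (Sum.inr p)) 0
      (fun y hy => h.inv_rr hy p k) hx, map_zero]; rfl
  have hB : ∀ (k : Fin n) (c : Idx n),
      pd c (fun y => torsionContraction G w k y (Sum.inr p) (Sum.inr q)) x =
      evalAt S x (pdOn hS c (-∑ i, ∑ j, K p i * K q j *
        (pdOn hS (Sum.inl i) (H j k) - pdOn hS (Sum.inl j) (H i k)))) := fun k c =>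
    pd_eq_pdOn hS c _ (fun y hy => h.torsionContraction_rr hS hy k p q) hx
  simp only [sigmaComps, schouten, Matrix.of_apply, hv, hB, mul_zero, sub_zero,
    Fintype.sum_sum_type]
  simp only [sharpDzbar, h.inv_rr hx, h.inv_lr hx, zero_mul, Finset.sum_const_zero, neg_zero,
    add_zero, map_neg, mul_neg, Finset.sum_neg_distrib]
  simp only [map_sum (evalAt S x) (fun k => ∑ l, _), map_sum (evalAt S x) (fun l => _ * _),
    map_mul]

/-- Levi-Civita contributes ½(∂_k h_{jl} + ∂_j h_{kl}), and the torsion ½(∂_j h_{kl} − ∂_k h_{jl}).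
The derivative thus falls on the index j, and the trace over j = m is θ_k. -/
theorem bismut_lll (h : IsHermitianFrame S G w H K) (hS : IsOpen S) {x : Cn n} (hx : x ∈ S)
    (k j m : Fin n) : bismut G w x (Sum.inl k) (Sum.inl j) (Sum.inl m) =
      evalAt S x (∑ l, K l m * pdOn hS (Sum.inl j) (H k l)) := by
  simp only [bismut, leviCivita, Fintype.sum_sum_type, h.inv_ll hx, h.inv_lr hx, zero_mul,
    mul_zero, Finset.sum_const_zero, zero_add, h.pd_lr hS hx, h.pd_ll hS hx, dcD,
    h.extD_llr hS hx, eigJ, Finset.mul_sum, ← Finset.sum_sub_distrib, map_sum, map_mul, map_sub]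
  refine Finset.sum_congr rfl fun l _ => ?_
  generalize evalAt S x (K l m) = a
  generalize evalAt S x (pdOn hS (Sum.inl j) (H k l)) = b
  generalize evalAt S x (pdOn hS (Sum.inl k) (H j l)) = c
  linear_combination (-(1 / 2 : ℂ) * a * (c - b) * (Complex.I * Complex.I - 1)) * Complex.I_mul_I

theorem bismut_llr (h : IsHermitianFrame S G w H K) (hS : IsOpen S) {x : Cn n} (hx : x ∈ S)
    (k j m : Fin n) : bismut G w x (Sum.inl k) (Sum.inl j) (Sum.inr m) = 0 := by
  simp only [bismut, leviCivita, Fintype.sum_sum_type, h.inv_rr hx, zero_mul,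
    mul_zero, Finset.sum_const_zero, h.pd_ll hS hx, dcD, h.extD_lll hS hx, add_zero, sub_zero,
    neg_zero]

theorem bismut_lrr (h : IsHermitianFrame S G w H K) (hS : IsOpen S) {x : Cn n} (hx : x ∈ S)
    (k j m : Fin n) : bismut G w x (Sum.inl k) (Sum.inr j) (Sum.inr m) =
      evalAt S x (∑ l, K m l *
        (pdOn hS (Sum.inl k) (H l j) - pdOn hS (Sum.inl l) (H k j))) := by
  simp only [bismut, leviCivita, Fintype.sum_sum_type, h.inv_rr hx, h.inv_rl hx, zero_mul,
    mul_zero, Finset.sum_const_zero, add_zero, h.pd_lr hS hx, h.pd_rl hS hx, h.pd_ll hS hx, dcD,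
    h.extD_lrl hS hx, eigJ, Finset.mul_sum, ← Finset.sum_sub_distrib, map_sum, map_mul, map_sub]
  refine Finset.sum_congr rfl fun l _ => ?_
  generalize evalAt S x (K m l) = a
  generalize evalAt S x (pdOn hS (Sum.inl k) (H l j)) = b
  generalize evalAt S x (pdOn hS (Sum.inl l) (H k j)) = c
  linear_combination ((1 / 2 : ℂ) * a * (b - c) * (Complex.I * Complex.I - 1)) * Complex.I_mul_I

/-- Type preservation: the torsion term cancels the Levi-Civita term, which need not vanish alone.
-/
theorem bismut_lrl (h : IsHermitianFrame S G w H K) (hS : IsOpen S) {x : Cn n} (hx : x ∈ S)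
    (k j m : Fin n) : bismut G w x (Sum.inl k) (Sum.inr j) (Sum.inl m) = 0 := by
  simp only [bismut, leviCivita, Fintype.sum_sum_type, h.inv_ll hx, h.inv_lr hx, zero_mul,
    mul_zero, Finset.sum_const_zero, zero_add, h.pd_lr hS hx, h.pd_rr hS hx, dcD,
    h.extD_lrr hS hx, eigJ, Finset.mul_sum, ← Finset.sum_sub_distrib, map_sub]
  refine Finset.sum_eq_zero fun l _ => ?_
  generalize evalAt S x (K l m) = a
  generalize evalAt S x (pdOn hS (Sum.inr j) (H k l)) = b
  generalize evalAt S x (pdOn hS (Sum.inr l) (H k j)) = c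
  linear_combination ((1 / 2 : ℂ) * a * (c - b) * (Complex.I * Complex.I - 1)) * Complex.I_mul_I

theorem bismutRicciComps_eq (h : IsHermitianFrame S G w H K) (hS : IsOpen S) {x : Cn n}
    (hx : x ∈ S) (j k : Fin n) : bismutRicciComps G w x (Sum.inl j) (Sum.inl k) =
      Complex.I * evalAt S x
        (pdOn hS (Sum.inl j) (bismutTrace (fun i => pdOn hS (Sum.inl i)) H K k) -
          pdOn hS (Sum.inl k) (bismutTrace (fun i => pdOn hS (Sum.inl i)) H K j)) := by
  set D := fun i : Fin n => pdOn hS (Sum.inl i) with hD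
  have t1 : ∀ k, ∑ c, ∑ l, K l c * D c (H k l) = bismutTrace D H K k := fun k =>
    Finset.sum_comm
  have t2 : ∀ k, ∑ c, ∑ l, K c l * (D k (H l c) - D l (H k c)) =
      logDetDeriv D H K k - bismutTrace D H K k := fun k => by
    simp only [mul_sub, Finset.sum_sub_distrib, logDetDeriv, bismutTrace]
  have p1 : ∀ j k c : Fin n,
      pd (Sum.inl j) (fun y => bismut G w y (Sum.inl k) (Sum.inl c) (Sum.inl c)) x =
        evalAt S x (D j (∑ l, K l c * D c (H k l))) := fun j k c =>
    pd_eq_pdOn hS _ _ (fun y hy => h.bismut_lll hS hy k c c) hx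
  have p2 : ∀ j k c : Fin n,
      pd (Sum.inl j) (fun y => bismut G w y (Sum.inl k) (Sum.inr c) (Sum.inr c)) x =
        evalAt S x (D j (∑ l, K c l * (D k (H l c) - D l (H k c)))) := fun j k c =>
    pd_eq_pdOn hS _ _ (fun y hy => h.bismut_lrr hS hy k c c) hx
  -- The quadratic curvature terms have zero trace on each block, being the trace of a commutator.
  have comm : ∀ f g : Fin n → Fin n → ℂ, ∑ c, ∑ e, (f e c * g c e - g e c * f c e) = 0 := by
    intro f g
    simp only [Finset.sum_sub_distrib]
    rw [sub_eq_zero, Finset.sum_comm]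
    exact Finset.sum_congr rfl fun _ _ => Finset.sum_congr rfl fun _ _ => mul_comm _ _
  have s1 : ∑ c : Fin n, curvature (bismut G w) x (Sum.inl j) (Sum.inl k) (Sum.inl c) (Sum.inl c)
      = evalAt S x (D j (bismutTrace D H K k) - D k (bismutTrace D H K j)) := by
    simp only [curvature, Fintype.sum_sum_type, h.bismut_llr hS hx, h.bismut_lrl hS hx, mul_zero,
      sub_zero, Finset.sum_const_zero, add_zero, Finset.sum_add_distrib]
    rw [comm (fun a b => bismut G w x (Sum.inl j) (Sum.inl a) (Sum.inl b))
      (fun a b => bismut G w x (Sum.inl k) (Sum.inl a) (Sum.inl b)), add_zero,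
      Finset.sum_sub_distrib]
    simp only [p1]
    rw [← map_sum, ← map_sum, ← map_sum, ← map_sum, t1, t1, map_sub]
  have s2 : ∑ c : Fin n, curvature (bismut G w) x (Sum.inl j) (Sum.inl k) (Sum.inr c) (Sum.inr c)
      = -evalAt S x (D j (bismutTrace D H K k) - D k (bismutTrace D H K j)) := by
    simp only [curvature, Fintype.sum_sum_type, h.bismut_llr hS hx, h.bismut_lrl hS hx, mul_zero,
      sub_zero, Finset.sum_const_zero, zero_add, Finset.sum_add_distrib]
    rw [comm (fun a b => bismut G w x (Sum.inl j) (Sum.inr a) (Sum.inr b))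
      (fun a b => bismut G w x (Sum.inl k) (Sum.inr a) (Sum.inr b)), add_zero,
      Finset.sum_sub_distrib]
    simp only [p2]
    rw [← map_sum, ← map_sum, ← map_sum, ← map_sum, t2, t2, map_sub, map_sub,
      logDetDeriv_closed D (fun i j f => pdOn_comm hS _ _ f) h.mul_eq_one j k]
    simp only [map_sub]
    ring
  simp only [bismutRicciComps, Matrix.of_apply, Fintype.sum_sum_type, eigJ, ← Finset.mul_sum,
    s1, s2]
  ring

/-- The torsion bivector and the `(2,0)`-part of the Bismut-Ricci form correspond to each other
by raising both indices. -/
theorem sigmaComps_eq_bismutRicci (h : IsHermitianFrame S G w H K) (hS : IsOpen S) {x : Cn n}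
    (hx : x ∈ S) : sigmaComps G w x = Complex.I • ((evalAt S x).mapMatrix K *
      (Matrix.of fun j k => bismutRicciComps G w x (Sum.inl j) (Sum.inl k)) *
        ((evalAt S x).mapMatrix K).transpose) := by
  ext p q
  simp only [h.sigmaComps_eq hS hx, Matrix.smul_apply, Matrix.mul_apply, Matrix.of_apply,
    h.bismutRicciComps_eq hS hx, Matrix.transpose_apply, RingHom.mapMatrix_apply,
    Matrix.map_apply, map_sum, map_mul, Finset.sum_mul, Finset.mul_sum, smul_eq_mul]
  rw [Finset.sum_comm, ← Finset.sum_neg_distrib]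
  refine Finset.sum_congr rfl fun j _ => ?_
  rw [← Finset.sum_neg_distrib]
  refine Finset.sum_congr rfl fun i _ => ?_
  linear_combination (-(evalAt S x (K p i) * evalAt S x (K q j) * evalAt S x
    (pdOn hS (Sum.inl i) (bismutTrace (fun i => pdOn hS (Sum.inl i)) H K j) -
      pdOn hS (Sum.inl j) (bismutTrace (fun i => pdOn hS (Sum.inl i)) H K i)))) * Complex.I_mul_I

theorem sigmaComps_eq_zero_iff (h : IsHermitianFrame S G w H K) (hS : IsOpen S) {x : Cn n}
    (hx : x ∈ S) : sigmaComps G w x = 0 ↔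
      (Matrix.of fun j k => bismutRicciComps G w x (Sum.inl j) (Sum.inl k)) = 0 := by
  rw [h.sigmaComps_eq_bismutRicci hS hx]
  have h1 := congrArg (evalAt S x).mapMatrix h.mul_eq_one
  rw [map_mul, map_one] at h1
  refine ⟨fun h0 => ?_, fun h0 => by rw [h0, mul_zero, zero_mul, smul_zero]⟩
  have h0 := (smul_eq_zero.mp h0).resolve_left Complex.I_ne_zero
  generalize (Matrix.of fun j k => bismutRicciComps G w x (Sum.inl j) (Sum.inl k)) = P at h0 ⊢
  generalize (evalAt S x).mapMatrix H = H' at h1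
  generalize (evalAt S x).mapMatrix K = K' at h0 h1
  have h2 : K'.transpose * H'.transpose = 1 := by
    rw [← Matrix.transpose_mul, h1, Matrix.transpose_one]
  calc P = (H' * K') * P * (K'.transpose * H'.transpose) := by rw [h1, h2, one_mul, mul_one]
    _ = H' * (K' * P * K'.transpose) * H'.transpose := by simp only [mul_assoc]
    _ = 0 := by rw [h0, mul_zero, zero_mul]

/-- The `(2,0)`-part of the Bismut-Ricci form of a metric conformal to a Kähler metric. -/
theorem bismutRicciComps_eq_zero_of_conformal (h : IsHermitianFrame S G w H K) (hS : IsOpen S)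
    {G₀ w₀ : Cn n → Matrix (Idx n) (Idx n) ℂ} {H₀ K₀ : Matrix (Fin n) (Fin n) (smoothFun S)}
    (h₀ : IsHermitianFrame S G₀ w₀ H₀ K₀) {f f' : smoothFun S} (hf : f * f' = 1)
    (hH : H = f • H₀)
    (hd : ∀ y ∈ S, ∀ a b c, extD w₀ y a b c = 0) {x : Cn n} (hx : x ∈ S) :
    (Matrix.of fun j k => bismutRicciComps G w x (Sum.inl j) (Sum.inl k)) = 0 := by
  ext j k
  rw [Matrix.of_apply, h.bismutRicciComps_eq hS hx,
    bismutTrace_closed_of_conformal (fun i => pdOn hS (Sum.inl i))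
      (fun i j f => pdOn_comm hS _ _ f) h.mul_eq_one hf hH ?_ j k, sub_self, map_zero, mul_zero]
  · rfl
  · intro m k l
    refine Subtype.ext <| funext fun y => ?_
    by_cases hy : y ∈ S
    · have := h₀.extD_llr hS hy m k l
      rw [hd y hy, map_sub] at this
      exact sub_eq_zero.mp ((mul_eq_zero.mp this.symm).resolve_left Complex.I_ne_zero)
    -- The Kähler symmetry is an identity in the ring, so it is also needed off `S`; there both
    -- sides are 0 by the definition of `pdOn`.
    · exact (Set.indicator_of_notMem hy _).trans (Set.indicator_of_notMem hy _).symm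

end IsHermitianFrame

end LocalFormulas

/-! ### From real Hermitian bilinear forms to complex component matrices -/

section HermitianFields

variable {n : ℕ} {S : Set (Cn n)}

/-- `b` is a smooth Hermitian metric on the subset `S` of `ℂⁿ`. -/
structure IsHermitianFieldOn (b : Cn n → LinearMap.BilinForm ℝ (Cn n)) (S : Set (Cn n)) :
    Prop where
  symm : ∀ x ∈ S, ∀ v w, b x v w = b x w v
  pos : ∀ x ∈ S, ∀ v, v ≠ 0 → 0 < b x v v
  invariant : ∀ x ∈ S, ∀ v w, b x (Complex.I • v) (Complex.I • w) = b x v w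
  smooth : ∀ v w, ContDiffOn ℝ ∞ (fun x => b x v w) S

theorem I_smul_I_smul {E : Type*} [AddCommGroup E] [Module ℂ E] (v : E) :
    Complex.I • Complex.I • v = -v := by
  rw [smul_smul, Complex.I_mul_I, neg_one_smul]

theorem IsHermitianFieldOn.apply_I_left {b : Cn n → LinearMap.BilinForm ℝ (Cn n)}
    (hb : IsHermitianFieldOn b S) {x : Cn n} (hx : x ∈ S) (v w : Cn n) :
    b x (Complex.I • v) w = -b x v (Complex.I • w) := by
  rw [← hb.invariant x hx v (Complex.I • w), I_smul_I_smul, map_neg, neg_neg]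

theorem comps_ll {b : Cn n → LinearMap.BilinForm ℝ (Cn n)} (hb : IsHermitianFieldOn b S)
    {x : Cn n} (hx : x ∈ S) (j k : Fin n) : comps b x (Sum.inl j) (Sum.inl k) = 0 := by
  simp only [comps, Matrix.of_apply, frame, map_sub, LinearMap.sub_apply,
    LinearMap.BilinForm.baseChange_tmul, hb.apply_I_left hx, I_smul_I_smul, map_neg, neg_neg,
    Algebra.smul_def, Complex.coe_algebraMap]
  linear_combination ((1 / 4 : ℂ) *
    (b x (EuclideanSpace.single j 1) (EuclideanSpace.single k 1) : ℂ)) * Complex.I_mul_I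

theorem comps_rr {b : Cn n → LinearMap.BilinForm ℝ (Cn n)} (hb : IsHermitianFieldOn b S)
    {x : Cn n} (hx : x ∈ S) (j k : Fin n) : comps b x (Sum.inr j) (Sum.inr k) = 0 := by
  simp only [comps, Matrix.of_apply, frame, map_add, LinearMap.add_apply,
    LinearMap.BilinForm.baseChange_tmul, hb.apply_I_left hx, I_smul_I_smul, map_neg, neg_neg,
    Algebra.smul_def, Complex.coe_algebraMap]
  linear_combination ((1 / 4 : ℂ) *
    (b x (EuclideanSpace.single j 1) (EuclideanSpace.single k 1) : ℂ)) * Complex.I_mul_I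

theorem comps_lr {b : Cn n → LinearMap.BilinForm ℝ (Cn n)} (hb : IsHermitianFieldOn b S)
    {x : Cn n} (hx : x ∈ S) (j k : Fin n) : comps b x (Sum.inl j) (Sum.inr k) =
      (1 / 2 : ℂ) * (b x (EuclideanSpace.single j 1) (EuclideanSpace.single k 1) +
        Complex.I * b x (EuclideanSpace.single j 1) (Complex.I • EuclideanSpace.single k 1)) := by
  simp only [comps, Matrix.of_apply, frame, map_add, map_sub, LinearMap.sub_apply,
    LinearMap.BilinForm.baseChange_tmul, hb.apply_I_left hx, I_smul_I_smul, map_neg, neg_neg,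
    Algebra.smul_def, Complex.coe_algebraMap]
  linear_combination (-(1 / 4 : ℂ) *
    (b x (EuclideanSpace.single j 1) (EuclideanSpace.single k 1) : ℂ)) * Complex.I_mul_I

theorem comps_symm {b : Cn n → LinearMap.BilinForm ℝ (Cn n)} {x : Cn n}
    (hb : ∀ v w, b x v w = b x w v) (a c : Idx n) : comps b x a c = comps b x c a := by
  have : ∀ v w, LinearMap.BilinForm.baseChange ℂ (b x) v w =
      LinearMap.BilinForm.baseChange ℂ (b x) w v :=
    (LinearMap.BilinForm.IsSymm.baseChange ℂ (B₂ := b x) ⟨hb⟩).eq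
  exact this _ _

/-- The components of `ω = g(J ·, ·)`. -/
theorem comps_compLeft_I {b b' : Cn n → LinearMap.BilinForm ℝ (Cn n)} {x : Cn n}
    (h : ∀ v w, b' x v w = b x (Complex.I • v) w) (a c : Idx n) :
    comps b' x a c = eigJ a * comps b x a c := by
  have key : ∀ (j : Fin n) (t : ℂ ⊗[ℝ] Cn n),
      LinearMap.BilinForm.baseChange ℂ (b' x) (frame (Sum.inl j)) t =
        Complex.I * LinearMap.BilinForm.baseChange ℂ (b x) (frame (Sum.inl j)) t ∧
      LinearMap.BilinForm.baseChange ℂ (b' x) (frame (Sum.inr j)) t =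
        -Complex.I * LinearMap.BilinForm.baseChange ℂ (b x) (frame (Sum.inr j)) t := by
    intro j t
    induction t using TensorProduct.induction_on with
    | zero => simp
    | add s t hs ht =>
      simp only [map_add, hs.1, hs.2, ht.1, ht.2, mul_add, and_self]
    | tmul z w =>
      simp only [frame, map_add, map_sub, LinearMap.sub_apply, LinearMap.add_apply,
        LinearMap.BilinForm.baseChange_tmul, h, I_smul_I_smul, map_neg, LinearMap.neg_apply,
        Algebra.smul_def, Complex.coe_algebraMap]
      constructor
      · linear_combination ((1 / 2 : ℂ) * z *
          (b x (Complex.I • EuclideanSpace.single j 1) w : ℂ)) * Complex.I_mul_I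
      · linear_combination ((1 / 2 : ℂ) * z *
          (b x (Complex.I • EuclideanSpace.single j 1) w : ℂ)) * Complex.I_mul_I
  rcases a with j | j
  · exact (key j _).1
  · exact (key j _).2

theorem isUnit_comps_lr {b : Cn n → LinearMap.BilinForm ℝ (Cn n)} (hb : IsHermitianFieldOn b S)
    {x : Cn n} (hx : x ∈ S) :
    IsUnit (Matrix.of fun j k : Fin n => comps b x (Sum.inl j) (Sum.inr k)) := by
  rw [Matrix.isUnit_iff_isUnit_det, isUnit_iff_ne_zero, Ne, ← Matrix.exists_mulVec_eq_zero_iff]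
  rintro ⟨ξ, hξ, h0⟩
  -- The sesquilinear form with real part `b`, conjugate-linear in the second slot; the matrix
  -- entries are ½ s(e_j, e_k).
  let s : Cn n → Cn n → ℂ := fun v w => (b x v w : ℂ) + Complex.I * b x v (Complex.I • w)
  have s_add_left : ∀ v v' w, s (v + v') w = s v w + s v' w := fun v v' w => by
    simp only [s, map_add, LinearMap.add_apply, Complex.ofReal_add]; ring
  have s_add_right : ∀ v w w', s v (w + w') = s v w + s v w' := fun v w w' => by
    simp only [s, smul_add, map_add, Complex.ofReal_add]; ring
  have s_smul_left : ∀ (c : ℂ) v w, s (c • v) w = c * s v w := fun c v w => by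
    have : c • v = c.re • v + c.im • Complex.I • v := by
      conv_lhs => rw [← Complex.re_add_im c]
      rw [add_smul, mul_smul, Complex.coe_smul, Complex.coe_smul]
    conv_rhs => rw [← Complex.re_add_im c]
    simp only [this, s, map_add, map_smul, LinearMap.add_apply, LinearMap.smul_apply,
      hb.apply_I_left hx, I_smul_I_smul, map_neg, neg_neg, smul_eq_mul, Complex.ofReal_add,
      Complex.ofReal_mul, Complex.ofReal_neg]
    linear_combination (-(c.im : ℂ) * (b x v (Complex.I • w) : ℂ)) * Complex.I_mul_I
  have s_smul_right : ∀ (c : ℂ) v w, s v (c • w) = starRingEnd ℂ c * s v w := fun c v w => by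
    have : c • w = c.re • w + c.im • Complex.I • w := by
      conv_lhs => rw [← Complex.re_add_im c]
      rw [add_smul, mul_smul, Complex.coe_smul, Complex.coe_smul]
    have h' : Complex.I • c • w = c.re • Complex.I • w - c.im • w := by
      rw [this, smul_add, smul_comm, smul_comm _ c.im, I_smul_I_smul, smul_neg, sub_eq_add_neg]
    have hc : starRingEnd ℂ c = c.re - c.im * Complex.I := by
      apply Complex.ext <;> simp
    simp only [h', hc, s, map_sub]
    rw [this]
    simp only [map_add, map_smul, smul_eq_mul, Complex.ofReal_add,
      Complex.ofReal_mul, Complex.ofReal_sub]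
    linear_combination ((c.im : ℂ) * (b x v (Complex.I • w) : ℂ)) * Complex.I_mul_I
  let sl : Cn n →ₗ[ℂ] (Cn n →ₗ⋆[ℂ] ℂ) := LinearMap.mk₂'ₛₗ (RingHom.id ℂ) (starRingEnd ℂ) s
    s_add_left (fun c v w => s_smul_left c v w) s_add_right (fun c v w => s_smul_right c v w)
  -- Conjugating the kernel vector turns its equation into s(e_j, v) = 0 for all j. Then s(v, v) =
  -- 0, against positivity of b(v, v).
  let v : Cn n := WithLp.toLp 2 fun k => starRingEnd ℂ (ξ k)
  have hv : v = ∑ k, starRingEnd ℂ (ξ k) • EuclideanSpace.single k (1 : ℂ) := by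
    ext i
    simp [v, Finset.sum_apply, Pi.single_apply]
  have h1 : ∀ j, sl (EuclideanSpace.single j 1) v = 0 := by
    intro j
    have := congrFun h0 j
    simp only [Matrix.mulVec, dotProduct, Matrix.of_apply, comps_lr hb hx, Pi.zero_apply] at this
    rw [hv, map_sum]
    simp only [map_smulₛₗ, Complex.conj_conj, smul_eq_mul]
    have h2 : (1 / 2 : ℂ) * ∑ k, ξ k * sl (EuclideanSpace.single j 1)
        (EuclideanSpace.single k 1) = 0 := by
      rw [← this, Finset.mul_sum]
      refine Finset.sum_congr rfl fun k _ => ?_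
      change (1 / 2 : ℂ) * (ξ k * s _ _) = _
      simp only [s]
      ring
    exact (mul_eq_zero.mp h2).resolve_left (by norm_num)
  have h2 : sl v v = 0 := by
    have h2 : ∀ u, sl v u = ∑ k, starRingEnd ℂ (ξ k) * sl (EuclideanSpace.single k 1) u :=
      fun u => by
        rw [hv, map_sum, LinearMap.sum_apply]
        simp only [map_smul, LinearMap.smul_apply, smul_eq_mul]
    simp only [h2 v, h1, mul_zero, Finset.sum_const_zero]
  have h3 : b x v v = 0 := by
    have := congrArg Complex.re (show s v v = 0 from h2)
    simpa [s] using this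
  have hv0 : v ≠ 0 := fun h => hξ <| funext fun k => by
    have := congrArg (fun u : Cn n => u k) h
    simpa [v] using this
  exact (hb.pos x hx v hv0).ne' h3

theorem exists_isHermitianFrame {b b' : Cn n → LinearMap.BilinForm ℝ (Cn n)}
    (hb : IsHermitianFieldOn b S) (hb' : ∀ x ∈ S, ∀ v w, b' x v w = b x (Complex.I • v) w) :
    ∃ H K, IsHermitianFrame S (comps b) (comps b') H K := by
  obtain ⟨H, K, h1, h2⟩ := exists_smooth_inverse (S := S)
    (fun y => Matrix.of fun j k : Fin n => comps b y (Sum.inl j) (Sum.inr k))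
    (fun j k => ContDiffOn.congr (f := fun x => (1 / 2 : ℂ) *
        (b x (EuclideanSpace.single j 1) (EuclideanSpace.single k 1) +
          Complex.I * b x (EuclideanSpace.single j 1) (Complex.I • EuclideanSpace.single k 1)))
      (contDiffOn_const.mul
        ((Complex.ofRealCLM.contDiff.comp_contDiffOn (hb.smooth _ _)).add
          (contDiffOn_const.mul (Complex.ofRealCLM.contDiff.comp_contDiffOn (hb.smooth _ _)))))
      fun y hy => comps_lr hb hy j k)
    (fun y hy => isUnit_comps_lr hb hy)
  refine ⟨H, K, h1, fun y hy => ?_, fun y hy => comps_compLeft_I (hb' y hy)⟩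
  ext a c
  rcases a with j | j <;> rcases c with k | k
  · exact comps_ll hb hy j k
  · exact (h2 y hy j k).symm
  · exact (comps_symm (hb.symm y hy) _ _).trans (h2 y hy k j).symm
  · exact comps_rr hb hy j k

/-- A conformal factor between two smooth Hermitian metrics is smooth. -/
theorem contDiffOn_conformal_factor {b b₀ : Cn n → LinearMap.BilinForm ℝ (Cn n)}
    (hb : IsHermitianFieldOn b S) (hb₀ : IsHermitianFieldOn b₀ S) {f : Cn n → ℝ}
    (hf : ∀ x ∈ S, ∀ v w, b x v w = f x * b₀ x v w) (j : Fin n) : ContDiffOn ℝ ∞ f S := by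
  have hv : (EuclideanSpace.single j 1 : Cn n) ≠ 0 := fun h => by
    have := congrArg (fun u : Cn n => u j) h
    simp at this
  refine ((hb.smooth (EuclideanSpace.single j 1) (EuclideanSpace.single j 1)).div
    (hb₀.smooth (EuclideanSpace.single j 1) (EuclideanSpace.single j 1))
    fun x hx => (hb₀.pos x hx _ hv).ne').congr fun x hx => ?_
  rw [Pi.div_apply, hf x hx, mul_div_assoc, div_self (hb₀.pos x hx _ hv).ne', mul_one]

theorem baseChange_real_smul_apply {V : Type*} [AddCommGroup V] [Module ℝ V] (c : ℝ)
    (B : LinearMap.BilinForm ℝ V) (s t : ℂ ⊗[ℝ] V) :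
    LinearMap.BilinForm.baseChange ℂ (c • B) s t =
      (c : ℂ) * LinearMap.BilinForm.baseChange ℂ B s t := by
  induction s using TensorProduct.induction_on with
  | zero => simp
  | add s s' hs hs' => simp only [map_add, LinearMap.add_apply, hs, hs', mul_add]
  | tmul z v =>
    induction t using TensorProduct.induction_on with
    | zero => simp
    | add t t' ht ht' => simp only [map_add, ht, ht', mul_add]
    | tmul z' w =>
      simp only [LinearMap.BilinForm.baseChange_tmul, LinearMap.smul_apply, smul_eq_mul,
        Algebra.smul_def, Complex.coe_algebraMap, Complex.ofReal_mul]
      ring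

theorem bismutRicci_eq_zero_of_conformal {b b' b₀ b₀' : Cn n → LinearMap.BilinForm ℝ (Cn n)}
    (hS : IsOpen S) (hb : IsHermitianFieldOn b S)
    (hb' : ∀ x ∈ S, ∀ v w, b' x v w = b x (Complex.I • v) w) (hb₀ : IsHermitianFieldOn b₀ S)
    (hb₀' : ∀ x ∈ S, ∀ v w, b₀' x v w = b₀ x (Complex.I • v) w)
    {f : Cn n → ℝ} (hf0 : ∀ x, f x ≠ 0) (hf : ∀ x ∈ S, ∀ v w, b x v w = f x * b₀ x v w)
    (hd : ∀ x ∈ S, ∀ a c d, extD (comps b₀') x a c d = 0) {x : Cn n} (hx : x ∈ S) :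
    (Matrix.of fun j k => bismutRicciComps (comps b) (comps b') x (Sum.inl j) (Sum.inl k)) =
      0 := by
  -- Fixing an entry supplies the nonzero vector e_j on which the conformal factor is a quotient of
  -- smooth functions; for n = 0 there is nothing to prove.
  ext j k
  obtain ⟨H₀, K₀, h₀⟩ := exists_isHermitianFrame hb₀ hb₀'
  let F : smoothFun S := ⟨fun y => f y,
    Complex.ofRealCLM.contDiff.comp_contDiffOn (contDiffOn_conformal_factor hb hb₀ hf j)⟩
  obtain ⟨F', hF'⟩ :=
    (isUnit_smoothFun F fun y => Complex.ofReal_ne_zero.mpr (hf0 y)).exists_right_inv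
  have hcomps : ∀ y ∈ S, comps b y = F.1 y • comps b₀ y := fun y hy => by
    have : b y = f y • b₀ y := by
      ext v w
      exact hf y hy v w
    ext a c
    simp only [comps, Matrix.smul_apply, Matrix.of_apply, this]
    exact baseChange_real_smul_apply _ _ _ _
  have h : IsHermitianFrame S (comps b) (comps b') (F • H₀) (F' • K₀) := by
    refine ⟨?_, fun y hy => ?_, fun y hy => comps_compLeft_I (hb' y hy)⟩
    · rw [smul_mul_smul_comm, hF', h₀.mul_eq_one, one_smul]
    · rw [hcomps y hy, h₀.metric y hy, Matrix.fromBlocks_smul, smul_zero]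
      rfl
  exact congrFun (congrFun (h.bismutRicciComps_eq_zero_of_conformal hS h₀ hF' rfl hd hx) j) k

end HermitianFields
-- Transfer to the manifold through holomorphic charts
section Manifold

variable {n : ℕ} {M : Type*} [TopologicalSpace M] [ChartedSpace (Cn n) M]

theorem inChart_apply (b : BilinField n M) (φ : OpenPartialHomeomorph M (Cn n)) (x v w : Cn n) :
    inChart b φ x v w = b (φ.symm x) (mfderiv 𝓘(ℂ, Cn n) 𝓘(ℂ, Cn n) φ.symm x v)
      (mfderiv 𝓘(ℂ, Cn n) 𝓘(ℂ, Cn n) φ.symm x w) := rfl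

theorem mfderiv_I_smul (φ : OpenPartialHomeomorph M (Cn n)) (x v : Cn n) :
    mfderiv 𝓘(ℂ, Cn n) 𝓘(ℂ, Cn n) φ.symm x (Complex.I • v : Cn n) =
      Complex.I • mfderiv 𝓘(ℂ, Cn n) 𝓘(ℂ, Cn n) φ.symm x v :=
  map_smul (mfderiv 𝓘(ℂ, Cn n) 𝓘(ℂ, Cn n) φ.symm x) Complex.I v

theorem inChart_hermitianForm (b : BilinField n M) (φ : OpenPartialHomeomorph M (Cn n))
    (x v w : Cn n) : inChart (hermitianForm b) φ x v w = inChart b φ x (Complex.I • v) w := by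
  rw [inChart_apply, inChart_apply, mfderiv_I_smul]
  rfl

/-- Needed for positivity of the pulled-back metric. -/
theorem mfderiv_symm_injective {φ : OpenPartialHomeomorph M (Cn n)} (hφ : φ ∈ holCharts n M)
    {x : Cn n} (hx : x ∈ φ.target) :
    Function.Injective (mfderiv 𝓘(ℂ, Cn n) 𝓘(ℂ, Cn n) φ.symm x) := by
  have h : φ.MDifferentiable 𝓘(ℂ, Cn n) 𝓘(ℂ, Cn n) :=
    ⟨(contMDiffOn_of_mem_maximalAtlas hφ).mdifferentiableOn (by simp),
      (contMDiffOn_symm_of_mem_maximalAtlas hφ).mdifferentiableOn (by simp)⟩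
  exact h.symm.mfderiv_injective hx

theorem IsHermitianMetricOn.inChart {g : BilinField n M} {U : Set M}
    (hg : IsHermitianMetricOn g U) {φ : OpenPartialHomeomorph M (Cn n)}
    (hφ : φ ∈ holCharts n M) :
    IsHermitianFieldOn (inChart g φ) (φ.target ∩ φ.symm ⁻¹' U) where
  symm x hx v w := hg.symm _ hx.2 _ _
  pos x hx v hv := hg.pos _ hx.2 _ fun h =>
    hv (mfderiv_symm_injective hφ hx.1 (h.trans (map_zero _).symm))
  invariant x hx v w := by
    rw [inChart_apply, mfderiv_I_smul, mfderiv_I_smul]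
    exact hg.invariant _ hx.2 _ _
  smooth v w := hg.smooth φ hφ v w

theorem inChart_eq_mul_of_hermitianForm_eq_smul {g g₀ : BilinField n M} {c : ℝ}
    {φ : OpenPartialHomeomorph M (Cn n)} {x : Cn n}
    (h : hermitianForm g (φ.symm x) = c • hermitianForm g₀ (φ.symm x)) (v w : Cn n) :
    inChart g φ x v w = c * inChart g₀ φ x v w := by
  have h' : ∀ v, inChart (hermitianForm g) φ x v w =
      c * inChart (hermitianForm g₀) φ x v w := fun v => by
    rw [inChart_apply, h]
    rfl
  -- The metric is recovered from its form by g(v, w) = ω(−Jv, w).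
  have := h' (-(Complex.I • v))
  rwa [inChart_hermitianForm, inChart_hermitianForm, smul_neg, I_smul_I_smul, neg_neg] at this

theorem bismutRicci20_eq_zero_of_isLocallyConformallyKahler {g : BilinField n M}
    (hg : IsHermitianMetricOn g Set.univ) (hK : IsLocallyConformallyKahler g)
    {φ : OpenPartialHomeomorph M (Cn n)} (hφ : φ ∈ holCharts n M) {x : Cn n}
    (hx : x ∈ φ.target) : bismutRicci20 g φ x = 0 := by
  obtain ⟨U, hU, hpU, u, g₀, -, hg₀, hu⟩ := hK (φ.symm x)
  have hgU : IsHermitianMetricOn g U :=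
    ⟨fun p _ => hg.symm p trivial, fun p _ => hg.pos p trivial,
      fun p _ => hg.invariant p trivial,
      fun φ hφ v w => (hg.smooth φ hφ v w).mono fun y hy => ⟨hy.1, trivial⟩⟩
  exact bismutRicci_eq_zero_of_conformal (φ.isOpen_inter_preimage_symm hU) (hgU.inChart hφ)
    (fun y _ => inChart_hermitianForm g φ y) (hg₀.hermitian.inChart hφ)
    (fun y _ => inChart_hermitianForm g₀ φ y) (f := fun y => Real.exp (u (φ.symm y)))
    (fun y => (Real.exp_pos _).ne')
    (fun y hy => inChart_eq_mul_of_hermitianForm_eq_smul (hu _ hy.2))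
    (fun y hy => hg₀.closed φ hφ y hy) ⟨hx, hpU⟩

theorem torsionBivector_eq_zero_iff {g : BilinField n M} (hg : IsHermitianMetricOn g Set.univ)
    {φ : OpenPartialHomeomorph M (Cn n)} (hφ : φ ∈ holCharts n M) {x : Cn n}
    (hx : x ∈ φ.target) : torsionBivector g φ x = 0 ↔ bismutRicci20 g φ x = 0 := by
  obtain ⟨H, K, h⟩ := exists_isHermitianFrame (hg.inChart hφ)
    (fun y _ => inChart_hermitianForm g φ y)
  exact h.sigmaComps_eq_zero_iff (φ.isOpen_inter_preimage_symm isOpen_univ) ⟨hx, trivial⟩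

end Manifold

end HermGeom

end

theorem mainTheorem11 (n : ℕ) (M : Type*) [TopologicalSpace M]
    [ChartedSpace (HermGeom.Cn n) M] [IsManifold 𝓘(ℂ, HermGeom.Cn n) ω M]
    (g : HermGeom.BilinField n M) (hg : HermGeom.IsHermitianMetricOn g Set.univ) :
    (HermGeom.IsLocallyConformallyKahler g →
      ∀ φ ∈ HermGeom.holCharts n M, ∀ x ∈ φ.target,
        HermGeom.torsionBivector g φ x = 0 ∧ HermGeom.bismutRicci20 g φ x = 0) ∧
    (∀ φ ∈ HermGeom.holCharts n M, ∀ x ∈ φ.target,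
      HermGeom.torsionBivector g φ x = 0 ↔ HermGeom.bismutRicci20 g φ x = 0) := by
  have hiff : ∀ φ ∈ HermGeom.holCharts n M, ∀ x ∈ φ.target,
      (HermGeom.torsionBivector g φ x = 0 ↔ HermGeom.bismutRicci20 g φ x = 0) :=
    fun φ hφ x hx => HermGeom.torsionBivector_eq_zero_iff hg hφ hx
  refine ⟨fun hK φ hφ x hx => ?_, hiff⟩
  have h0 := HermGeom.bismutRicci20_eq_zero_of_isLocallyConformallyKahler hg hK hφ hx
  exact ⟨(hiff φ hφ x hx).mpr h0, h0⟩
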